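/- **Lemma 1.2.** Let $X$ be a noetherian, separated, normal scheme and let $D=\{D_1,\dots,D_r\}$ be a finite (possibly empty) set of prime divisors on $X$, that is, of irreducible, reduced, closed subschemes of codimension $1$; let $\eta_j$ be the generic point of $D_j$. A *Mumford divisor* on $(X,D)$ is a Weil divisor $B=\sum_i m_iB_i$ on $X$ (a finite sum with $m_i\in\mathbb Z$ nonzero and the $B_i$ distinct prime divisors) such that none of the $B_i$ is among the $D_j$. Let $\mathrm{MDiv}(X,D)\subset \mathrm{WDiv}(X)$ be the group of Mumford divisors. Two Mumford divisors $B',B''$ on $(X,D)$ are *linearly equivalent modulo $D$* if there is an invertible rational function $\phi$ on $X$ such that $(\phi)=B'-B''$ and $\phi$ is regular and nonvanishing at $\eta_1,\dots,\eta_r$ (that is, it is a unit of each local ring $\mathcal O_{X,\eta_j}$). Let $\mathrm{MCl}(X,D)$, the *Mumford class group* of $(X,D)$, be the quotient of $\mathrm{MDiv}(X,D)$ by this equivalence relation, and let $\mathrm{Cl}(X)=\mathrm{WDiv}(X)/\{(\phi)\}$ be the usual divisor class group, where $\phi$ runs over the invertible rational functions on $X$. Then the inclusion $\mathrm{MDiv}(X,D)\subset\mathrm{WDiv}(X)$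 induces an isomorphism of groups $$\mathrm{MCl}(X,D)\;\cong\;\mathrm{Cl}(X).$$ -/

import Mathlib

open AlgebraicGeometry TopologicalSpace nonZeroDivisors

universe u

noncomputable section

namespace Mumford

/-- A scheme is normal if all its local rings are integrally closed domains. -/
class IsNormal (X : Scheme.{u}) : Prop where
  isDomain_stalk : ∀ x : X, IsDomain (X.presheaf.stalk x)
  isIntegrallyClosed_stalk : ∀ x : X, IsIntegrallyClosed (X.presheaf.stalk x)

/-- A prime divisor on `X`: an irreducible closed subset (equivalently, an irreducible, reduced
closed subscheme) of codimension one. The codimension of `Z` is the supremum of the lengths of the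
chains of irreducible closed subsets that start at `Z` and go up. -/
structure PrimeDivisor (X : Scheme.{u}) where
  /-- the underlying irreducible closed subset -/
  toIrreducibleCloseds : IrreducibleCloseds X
  codim_eq_one : Order.coheight toIrreducibleCloseds = 1

/-- The generic point of a prime divisor. -/
def PrimeDivisor.genericPoint {X : Scheme.{u}} (P : PrimeDivisor X) : X :=
  P.toIrreducibleCloseds.isIrreducible'.genericPoint

/-- Weil divisors with integral coefficients: formal finite `ℤ`-linear combinations of prime
divisors. -/
abbrev WeilDivisor (X : Scheme.{u}) : Type u := PrimeDivisor X →₀ ℤ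

/-- The ring of rational functions of `X`: the product of the local rings of `X` at the generic
points of its irreducible components. For a scheme with finitely many irreducible components,
in particular for a noetherian scheme, this is the ring of equivalence classes of regular functions
on dense open subsets; for an integral scheme it is the function field. -/
abbrev RationalFunctions (X : Scheme.{u}) : Type u :=
  ∀ η : genericPoints X, X.presheaf.stalk η.1

/-- The canonical map from the local ring at `x` to the local ring at a generization `y` of `x`. -/
abbrev toStalk {X : Scheme.{u}} {x y : X} (h : y ⤳ x) :
    X.presheaf.stalk x →+* X.presheaf.stalk y :=
  (X.presheaf.stalkSpecializes h).hom

/-- `HasOrder φ x n`: the rational function `φ` vanishes to order `n` at the codimension one point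
`x`. That is, near `x` one can write `φ = a / b` with non-zero-divisors `a, b` of the local ring
`R` at `x`, and `n = length (R / a) - length (R / b)`. When `R` is a discrete valuation ring this
says that `φ` has valuation `n`. -/
def HasOrder {X : Scheme.{u}} (φ : RationalFunctions X) (x : X) (n : ℤ) : Prop :=
  ∃ a ∈ (X.presheaf.stalk x)⁰, ∃ b ∈ (X.presheaf.stalk x)⁰,
    (∀ (η : genericPoints X) (h : η.1 ⤳ x), toStalk h a = φ η * toStalk h b) ∧
    ∃ k l : ℕ, Ring.ord (X.presheaf.stalk x) a = k ∧ Ring.ord (X.presheaf.stalk x) b = l ∧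
      n = (k : ℤ) - l

/-- The rational function `φ` is regular and nonvanishing at the point `x`, that is, near `x` it is
given by a unit of the local ring at `x`. -/
def IsRegularNonvanishingAt {X : Scheme.{u}} (φ : RationalFunctions X) (x : X) : Prop :=
  ∃ a : (X.presheaf.stalk x)ˣ, ∀ (η : genericPoints X) (h : η.1 ⤳ x), toStalk h a = φ η

/-- `IsDivisorOf φ B`: the equality `(φ) = B`, where `(φ)` is the divisor of `φ`. -/
def IsDivisorOf {X : Scheme.{u}} (φ : RationalFunctions X) (B : WeilDivisor X) : Prop :=
  ∀ P : PrimeDivisor X, HasOrder φ P.genericPoint (B P)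

section Lemmas

variable {X : Scheme.{u}}

theorem HasOrder.one (x : X) : HasOrder (1 : RationalFunctions X) x 0 :=
  ⟨1, one_mem _, 1, one_mem _, by simp, 0, 0, by simp⟩

theorem HasOrder.mul {φ ψ : RationalFunctions X} {x : X} {m n : ℤ} (hφ : HasOrder φ x m)
    (hψ : HasOrder ψ x n) : HasOrder (φ * ψ) x (m + n) := by
  obtain ⟨a, ha, b, hb, hab, k, l, hk, hl, rfl⟩ := hφ
  obtain ⟨c, hc, d, hd, hcd, k', l', hk', hl', rfl⟩ := hψ
  refine ⟨a * c, mul_mem ha hc, b * d, mul_mem hb hd, fun η h ↦ ?_, k + k', l + l', ?_, ?_, ?_⟩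
  · rw [map_mul, map_mul, hab, hcd, Pi.mul_apply]
    ring
  · rw [Ring.ord_mul _ hc, hk, hk']
    norm_cast
  · rw [Ring.ord_mul _ hd, hl, hl']
    norm_cast
  · push_cast
    ring

theorem HasOrder.inv {φ : (RationalFunctions X)ˣ} {x : X} {n : ℤ}
    (hφ : HasOrder (φ : RationalFunctions X) x n) :
    HasOrder ((φ⁻¹ : (RationalFunctions X)ˣ) : RationalFunctions X) x (-n) := by
  obtain ⟨a, ha, b, hb, hab, k, l, hk, hl, rfl⟩ := hφ
  refine ⟨b, hb, a, ha, fun η h ↦ ?_, l, k, hl, hk, by ring⟩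
  have h1 : (φ⁻¹ : (RationalFunctions X)ˣ).1 η * φ.1 η = 1 := by
    rw [← Pi.mul_apply, Units.inv_mul, Pi.one_apply]
  rw [hab, ← mul_assoc, h1, one_mul]

theorem IsRegularNonvanishingAt.one (x : X) :
    IsRegularNonvanishingAt (1 : RationalFunctions X) x :=
  ⟨1, by simp⟩

theorem IsRegularNonvanishingAt.mul {φ ψ : RationalFunctions X} {x : X}
    (hφ : IsRegularNonvanishingAt φ x) (hψ : IsRegularNonvanishingAt ψ x) :
    IsRegularNonvanishingAt (φ * ψ) x := by
  obtain ⟨a, ha⟩ := hφ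
  obtain ⟨b, hb⟩ := hψ
  exact ⟨a * b, fun η h ↦ by rw [Units.val_mul, map_mul, ha, hb, Pi.mul_apply]⟩

theorem IsRegularNonvanishingAt.inv {φ : (RationalFunctions X)ˣ} {x : X}
    (hφ : IsRegularNonvanishingAt (φ : RationalFunctions X) x) :
    IsRegularNonvanishingAt ((φ⁻¹ : (RationalFunctions X)ˣ) : RationalFunctions X) x := by
  obtain ⟨a, ha⟩ := hφ
  refine ⟨a⁻¹, fun η h ↦ ?_⟩
  have h1 : φ.1 η * (φ⁻¹ : (RationalFunctions X)ˣ).1 η = 1 := by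
    rw [← Pi.mul_apply, Units.mul_inv, Pi.one_apply]
  have h2 : toStalk h (a⁻¹ : (X.presheaf.stalk x)ˣ).1 * toStalk h a.1 = 1 := by
    rw [← map_mul, Units.inv_mul, map_one]
  rw [ha] at h2
  exact left_inv_eq_right_inv h2 h1

end Lemmas

/-- The principal Weil divisors: the divisors of the invertible rational functions. -/
def principalDivisors (X : Scheme.{u}) : AddSubgroup (WeilDivisor X) where
  carrier := {B | ∃ φ : (RationalFunctions X)ˣ, IsDivisorOf (φ : RationalFunctions X) B}
  zero_mem' := ⟨1, fun _ ↦ HasOrder.one _⟩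
  add_mem' := by
    rintro B C ⟨φ, hφ⟩ ⟨ψ, hψ⟩
    exact ⟨φ * ψ, fun P ↦ (hφ P).mul (hψ P)⟩
  neg_mem' := by
    rintro B ⟨φ, hφ⟩
    exact ⟨φ⁻¹, fun P ↦ (hφ P).inv⟩

/-- The divisor class group: Weil divisors modulo linear equivalence, where `B'` and `B''` are
linearly equivalent if `B' - B''` is principal. -/
abbrev ClassGroup (X : Scheme.{u}) : Type u := WeilDivisor X ⧸ principalDivisors X

/-- The Mumford divisors on `(X, D)`: the Weil divisors in which no member of `D` occurs. -/
def mumfordDivisors (X : Scheme.{u}) (D : Set (PrimeDivisor X)) :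
    AddSubgroup (WeilDivisor X) where
  carrier := {B | ∀ P ∈ D, B P = 0}
  zero_mem' := fun _ _ ↦ rfl
  add_mem' := by
    intro B C hB hC P hP
    rw [Finsupp.add_apply, hB P hP, hC P hP, add_zero]
  neg_mem' := by
    intro B hB P hP
    rw [Finsupp.neg_apply, hB P hP, neg_zero]

/-- The Mumford divisors on `(X, D)` that are linearly equivalent to zero modulo `D`: the divisors
of the invertible rational functions that are regular and nonvanishing at the generic points of
all members of `D`. -/
def principalMumfordDivisors (X : Scheme.{u}) (D : Set (PrimeDivisor X)) :
    AddSubgroup (mumfordDivisors X D) where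
  carrier := {B | ∃ φ : (RationalFunctions X)ˣ,
    IsDivisorOf (φ : RationalFunctions X) (B : WeilDivisor X) ∧
      ∀ P ∈ D, IsRegularNonvanishingAt (φ : RationalFunctions X) P.genericPoint}
  zero_mem' := ⟨1, fun _ ↦ HasOrder.one _, fun _ _ ↦ IsRegularNonvanishingAt.one _⟩
  add_mem' := by
    rintro B C ⟨φ, hφ, hφ'⟩ ⟨ψ, hψ, hψ'⟩
    exact ⟨φ * ψ, fun P ↦ (hφ P).mul (hψ P), fun P hP ↦ (hφ' P hP).mul (hψ' P hP)⟩
  neg_mem' := by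
    rintro B ⟨φ, hφ, hφ'⟩
    exact ⟨φ⁻¹, fun P ↦ (hφ P).inv, fun P hP ↦ (hφ' P hP).inv⟩

/-- The Mumford class group of `(X, D)`: Mumford divisors modulo linear equivalence modulo `D`,
where `B'` and `B''` are linearly equivalent modulo `D` if `B' - B''` is the divisor of a rational
function that is regular and nonvanishing at the generic points of the members of `D`. -/
abbrev MumfordClassGroup (X : Scheme.{u}) (D : Set (PrimeDivisor X)) : Type u :=
  mumfordDivisors X D ⧸ principalMumfordDivisors X D

end Mumford

end

/-! By normality the local ring at the generic point of a prime divisor is a discrete valuation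
ring, so orders are valuations and order zero means being a unit. A principal divisor avoiding `D`
is thus the divisor of a function that is a unit along `D`: this is injectivity
(`mumfordDivisors_inclusion_ker`).

For surjectivity, subtract from `B` the divisor of a function with the same orders as `B` along `D`
(`exists_mumfordDivisor_sub_mem`). Such a function comes from weak approximation
(`IsFractionMap.exists_hasOrd_eq`), once distinct prime divisors are known to give inequivalent
valuations; this is where separatedness enters (`specializes_of_range_le`). Noetherianity makes its
divisor a finite sum (`exists_isDivisorOf`).

`X` may be reducible, but each point lies on only one irreducible component, so one can work one
component at a time. -/

namespace Mumford

/-! ### Orders in the fraction field of a discrete valuation ring -/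

/-- `HasOrd f z n`: the element `z` of the fraction field has order `n` with respect to `f`. -/
def HasOrd {R K : Type*} [CommRing R] [CommRing K] (f : R →+* K) (z : K) (n : ℤ) : Prop :=
  ∃ a ∈ R⁰, ∃ b ∈ R⁰, f a = z * f b ∧
    ∃ k l : ℕ, Ring.ord R a = k ∧ Ring.ord R b = l ∧ n = (k : ℤ) - l

theorem hasOrd_algebraMap_iff {R K : Type*} [CommRing R] [IsDomain R] [IsDiscreteValuationRing R]
    [Field K] [Algebra R K] [IsFractionRing R K] (z : K) (n : ℤ) :
    HasOrd (algebraMap R K) z n ↔ Ring.ordFrac R z = WithZero.exp n := by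
  have key : ∀ {a : R} {k : ℕ}, a ∈ R⁰ → Ring.ord R a = k →
      Ring.ordFrac R (algebraMap R K a) = WithZero.exp (k : ℤ) := by
    intro a k ha hk
    rw [Ring.ordFrac_eq_ord R (nonZeroDivisors.ne_zero ha), Ring.ordMonoidWithZeroHom_eq_coe R ha hk]
    rfl
  constructor
  · rintro ⟨a, ha, b, hb, hab, k, l, hk, hl, rfl⟩
    have hb' : algebraMap R K b ≠ 0 := by
      simpa using nonZeroDivisors.ne_zero hb
    rw [eq_div_of_mul_eq hb' hab.symm, map_div₀, key ha hk, key hb hl, WithZero.exp_sub]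
  · intro h
    have hz : z ≠ 0 := by
      rintro rfl
      exact WithZero.exp_ne_zero ((map_zero _).symm.trans h).symm
    obtain ⟨a, b, hb, rfl⟩ := IsFractionRing.div_surjective (A := R) z
    have hb' : algebraMap R K b ≠ 0 := by
      simpa using nonZeroDivisors.ne_zero hb
    have ha : a ∈ R⁰ := mem_nonZeroDivisors_of_ne_zero (by rintro rfl; simp at hz)
    obtain ⟨k, hk⟩ := ENat.ne_top_iff_exists.mp (Ring.ord_ne_top ha)
    obtain ⟨l, hl⟩ := ENat.ne_top_iff_exists.mp (Ring.ord_ne_top hb)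
    refine ⟨a, ha, b, hb, (div_mul_cancel₀ _ hb').symm, k, l, hk.symm, hl.symm, ?_⟩
    rw [map_div₀, key ha hk.symm, key hb hl.symm, ← WithZero.exp_sub] at h
    exact (WithZero.exp_injective h).symm

/-- A ring homomorphism to a field that exhibits its target as the fraction field of its source. -/
def IsFractionMap {R K : Type*} [CommRing R] [CommRing K] (f : R →+* K) : Prop :=
  IsField K ∧ @IsFractionRing R _ K _ f.toAlgebra

section DVR

variable {R K : Type*} [CommRing R] [IsDomain R] [IsDiscreteValuationRing R] [CommRing K]
  {f : R →+* K}

theorem IsFractionMap.exists_hasOrd (hf : IsFractionMap f) {z : K} (hz : z ≠ 0) :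
    ∃ n, HasOrd f z n := by
  let _ := hf.1.toField
  let _ := f.toAlgebra
  have : IsFractionRing R K := hf.2
  have h0 : Ring.ordFrac R z ≠ 0 := (map_ne_zero _).mpr hz
  exact ⟨_, (hasOrd_algebraMap_iff z _).mpr (WithZero.exp_log h0).symm⟩

theorem IsFractionMap.hasOrd_unique (hf : IsFractionMap f) {z : K} {m n : ℤ}
    (hm : HasOrd f z m) (hn : HasOrd f z n) : m = n := by
  let _ := hf.1.toField
  let _ := f.toAlgebra
  have : IsFractionRing R K := hf.2
  have hm' := (hasOrd_algebraMap_iff z m).mp hm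
  have hn' := (hasOrd_algebraMap_iff z n).mp hn
  exact WithZero.exp_injective (hm'.symm.trans hn')

/-- Order zero means valuation one, for `z` and for `z⁻¹`; both then lift to `R`, and the lifts are
mutually inverse. -/
theorem IsFractionMap.hasOrd_zero_iff (hf : IsFractionMap f) {z : K} :
    HasOrd f z 0 ↔ ∃ u : Rˣ, f u = z := by
  let _ := hf.1.toField
  let _ := f.toAlgebra
  have : IsFractionRing R K := hf.2
  refine Iff.trans (hasOrd_algebraMap_iff z 0) ?_
  rw [Ring.ordFrac_eq_valuation_inv, WithZero.exp_zero, inv_eq_one]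
  constructor
  · intro h
    obtain ⟨a, ha⟩ := IsDiscreteValuationRing.exists_lift_of_le_one h.le
    obtain ⟨b, hb⟩ := IsDiscreteValuationRing.exists_lift_of_le_one (A := R) (x := z⁻¹)
      (by rw [map_inv₀, h, inv_one])
    have hz : z ≠ 0 := by
      rintro rfl
      simp at h
    have hab : a * b = 1 := IsFractionRing.injective R K (by
      rw [map_mul, ha, hb, map_one, mul_inv_cancel₀ hz])
    exact ⟨⟨a, b, hab, mul_comm a b ▸ hab⟩, ha⟩
  · rintro ⟨u, rfl⟩
    have := Ring.ordFrac_of_isUnit (R := R) (K := K) u.isUnit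
    rwa [Ring.ordFrac_eq_valuation_inv, inv_eq_one] at this

/-- Weak approximation: non-inclusion of the valuation rings makes the absolute values inequivalent,
so `K` is dense in the product of its copies with these topologies. Approximate powers of
uniformizers. -/
theorem IsFractionMap.exists_hasOrd_eq {ι K : Type*} [Finite ι] [CommRing K] {R : ι → Type*}
    [∀ i, CommRing (R i)] [∀ i, IsDomain (R i)] [∀ i, IsDiscreteValuationRing (R i)]
    {f : ∀ i, R i →+* K} (hK : IsField K) (hf : ∀ i, IsFractionMap (f i))
    (h : ∀ i j, i ≠ j → ¬ (f i).range ≤ (f j).range) (m : ι → ℤ) :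
    ∃ z : K, z ≠ 0 ∧ ∀ i, HasOrd (f i) z (m i) := by
  let _ := hK.toField
  let _ : ∀ i, Algebra (R i) K := fun i ↦ (f i).toAlgebra
  have _ : ∀ i, IsFractionRing (R i) K := fun i ↦ (hf i).2
  let v (i) : Valuation K (WithZero (Multiplicative ℤ)) :=
    (IsDiscreteValuationRing.maximalIdeal (R i)).valuation K
  let w (i) : AbsoluteValue K ℝ :=
    (IsDiscreteValuationRing.maximalIdeal (R i)).adicAbv (K := K) (b := 2) one_lt_two
  have hw_le (i x y) : w i x ≤ w i y ↔ v i x ≤ v i y :=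
    NNReal.coe_le_coe.trans (WithZeroMulInt.toNNReal_strictMono one_lt_two).le_iff_le
  have hw_lt (i x y) : w i x < w i y ↔ v i x < v i y :=
    NNReal.coe_lt_coe.trans (WithZeroMulInt.toNNReal_strictMono one_lt_two).lt_iff_lt
  have hrange (i x) : v i x ≤ 1 ↔ x ∈ (f i).range :=
    ⟨fun hx ↦ IsDiscreteValuationRing.exists_lift_of_le_one hx, by
      rintro ⟨a, rfl⟩
      exact IsDedekindDomain.HeightOneSpectrum.valuation_le_one _ a⟩
  have hπ (i) (n : ℤ) : ∃ p : K, Ring.ordFrac (R i) p = WithZero.exp n := by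
    obtain ⟨ϖ, hϖ⟩ := IsDiscreteValuationRing.exists_irreducible (R i)
    refine ⟨(algebraMap (R i) K ϖ) ^ n, ?_⟩
    rw [map_zpow₀, Ring.ordFrac_irreducible hϖ, ← WithZero.exp_zsmul]
    simp
  have hnontriv (i) : (w i).IsNontrivial := by
    obtain ⟨p, hp⟩ := hπ i 1
    have hp0 : p ≠ 0 := by
      rintro rfl
      exact WithZero.exp_ne_zero ((map_zero _).symm.trans hp).symm
    refine ⟨p, hp0, fun h1 ↦ ?_⟩
    have h2 : v i p = v i 1 := by
      rw [← map_one (w i)] at h1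
      exact le_antisymm ((hw_le i _ _).mp h1.le) ((hw_le i _ _).mp h1.ge)
    rw [Ring.ordFrac_eq_valuation_inv] at hp
    change (v i p)⁻¹ = _ at hp
    rw [h2, map_one, inv_one, ← WithZero.exp_zero] at hp
    exact zero_ne_one (WithZero.exp_injective hp)
  have hpair : Pairwise fun i j ↦ ¬ (w i).IsEquiv (w j) := by
    intro i j hij hw
    refine h i j hij fun x hx ↦ ?_
    rw [← hrange, ← map_one (v j), ← hw_le, ← hw, hw_le, map_one, hrange]
    exact hx
  choose p hp using fun i ↦ hπ i (m i)
  have hp0 (i) : p i ≠ 0 := by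
    intro h0
    have hpi := hp i
    rw [h0, map_zero] at hpi
    exact WithZero.exp_ne_zero hpi.symm
  -- The radius is the absolute value of the centre, so the ultrametric inequality gives `z` the
  -- same valuation as `p i`.
  obtain ⟨z, hz⟩ := (AbsoluteValue.denseRange_algebraMap_pi hnontriv hpair).exists_mem_open
    (s := Set.pi Set.univ fun i ↦ Metric.ball (WithAbs.toAbs (w i) (p i)) (w i (p i)))
    (isOpen_set_pi Set.finite_univ fun _ _ ↦ Metric.isOpen_ball)
    ⟨fun i ↦ WithAbs.toAbs (w i) (p i), fun i _ ↦ Metric.mem_ball_self ((w i).pos (hp0 i))⟩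
  have hvz (i) : v i z = v i (p i) := by
    have h1 := hz i (Set.mem_univ i)
    rw [Metric.mem_ball, dist_eq_norm] at h1
    have h2 : w i (z - p i) < w i (p i) := h1
    rw [hw_lt] at h2
    exact (Valuation.map_eq_of_sub_lt _ h2)
  have hord (i) : Ring.ordFrac (R i) z = WithZero.exp (m i) := by
    rw [← hp i, Ring.ordFrac_eq_valuation_inv, Ring.ordFrac_eq_valuation_inv]
    exact congrArg _ (hvz i)
  -- With no conditions the approximating `z` could be zero; otherwise any one prescribed order
  -- excludes this.
  cases isEmpty_or_nonempty ι
  · exact ⟨1, one_ne_zero, fun i ↦ isEmptyElim i⟩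
  · refine ⟨z, ?_, fun i ↦ (hasOrd_algebraMap_iff z (m i)).mpr (hord i)⟩
    rintro rfl
    have h0 := hord (Classical.arbitrary ι)
    rw [map_zero] at h0
    exact WithZero.exp_ne_zero h0.symm

end DVR

open CategoryTheory Topology

/-! ### Prime divisors and local rings of a normal scheme -/

theorem IsNormal.isReduced (X : Scheme.{u}) [IsNormal X] : IsReduced X :=
  have (x : X) : _root_.IsReduced (X.presheaf.stalk x) :=
    have := IsNormal.isDomain_stalk x
    inferInstance
  isReduced_of_isReduced_stalk X

theorem PrimeDivisor.closure_genericPoint {X : Scheme.{u}} (P : PrimeDivisor X) :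
    closure {P.genericPoint} = (P.toIrreducibleCloseds : Set X) :=
  P.toIrreducibleCloseds.isIrreducible'.closure_genericPoint P.toIrreducibleCloseds.isClosed'

theorem PrimeDivisor.coheight_genericPoint {X : Scheme.{u}} (P : PrimeDivisor X) :
    Order.coheight P.genericPoint = 1 := by
  rw [← P.codim_eq_one, ← Order.coheight_orderIso (irreducibleSetEquivPoints (α := X))]
  rfl

theorem PrimeDivisor.eq_of_le {X : Scheme.{u}} {P Q : PrimeDivisor X}
    (h : P.toIrreducibleCloseds ≤ Q.toIrreducibleCloseds) : P = Q := by
  by_contra hne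
  have hlt : P.toIrreducibleCloseds < Q.toIrreducibleCloseds := by
    refine lt_of_le_of_ne h fun h' ↦ hne ?_
    cases P
    cases Q
    simpa using h'
  have h1 := Order.coheight_add_one_le hlt
  rw [P.codim_eq_one, Q.codim_eq_one] at h1
  exact absurd h1 (by decide)

/-- An irreducible closed subset that strictly contains a prime divisor is an irreducible
component. -/
theorem PrimeDivisor.mem_irreducibleComponents_of_lt {X : Scheme.{u}} {P : PrimeDivisor X}
    {W : IrreducibleCloseds X} (h : P.toIrreducibleCloseds < W) :
    (W : Set X) ∈ irreducibleComponents X := by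
  have h1 := Order.coheight_add_one_le h
  rw [P.codim_eq_one] at h1
  have h2 : Order.coheight W = 0 := by
    generalize Order.coheight W = c at h1
    induction c with
    | top => simp at h1
    | coe n => norm_cast at h1 ⊢; omega
  rw [Order.coheight_eq_zero] at h2
  refine ⟨W.isIrreducible', fun T hT hWT ↦ ?_⟩
  have h3 := h2 (b := ⟨closure T, hT.closure, isClosed_closure⟩)
    (show (W : Set X) ⊆ closure T from hWT.trans subset_closure)
  exact subset_closure.trans h3

theorem isDiscreteValuationRing_stalk {X : Scheme.{u}} [IsLocallyNoetherian X] [IsNormal X] {x : X}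
    (hx : Order.coheight x = 1) [IsDomain (X.presheaf.stalk x)] :
    IsDiscreteValuationRing (X.presheaf.stalk x) := by
  have hdim : ringKrullDim (X.presheaf.stalk x) = 1 := by
    rw [ringKrullDim_stalk_eq_coheight, hx]
    rfl
  have hfield : ¬ IsField (X.presheaf.stalk x) := fun h ↦ by
    rw [ringKrullDim_eq_zero_of_isField h] at hdim
    exact zero_ne_one hdim
  have hle : Ring.KrullDimLE 1 (X.presheaf.stalk x) := Ring.krullDimLE_iff.mpr hdim.le
  rw [Ring.krullDimLE_one_iff_of_noZeroDivisors] at hle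
  have h1 : IsDedekindDomain (X.presheaf.stalk x) :=
    { maximalOfPrime := fun hp hp' ↦ hle _ hp hp'
      toIsIntegralClosure := IsNormal.isIntegrallyClosed_stalk x }
  exact ((IsDiscreteValuationRing.TFAE _ hfield).out 2 0).mp h1

/-- Both stalks are localizations of the sections over one affine open. A section invertible at `y`
has nonzero germ at `x`, hence a regular germ as that stalk is a domain. -/
theorem isFractionMap_toStalk {X : Scheme.{u}} [IsNormal X] {x y : X}
    (hy : y ∈ genericPoints X) (h : y ⤳ x) : IsFractionMap (toStalk h) := by
  have := IsNormal.isReduced X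
  have := IsNormal.isDomain_stalk x
  have hK := isField_stalk_of_closure_mem_irreducibleComponents X y hy
  obtain ⟨_, ⟨U, hU, rfl⟩, hxU, -⟩ :=
    X.isBasis_affineOpens.exists_subset_of_mem_open (Set.mem_univ x) isOpen_univ
  have hyU : y ∈ U := h.mem_open U.isOpen hxU
  let _ := X.presheaf.algebra_section_stalk (⟨x, hxU⟩ : U)
  let _ := X.presheaf.algebra_section_stalk (⟨y, hyU⟩ : U)
  have hlx := hU.isLocalization_stalk ⟨x, hxU⟩
  have hly := hU.isLocalization_stalk ⟨y, hyU⟩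
  have hgerm (a : Γ(X, U)) : toStalk h (X.presheaf.germ U x hxU a) = X.presheaf.germ U y hyU a :=
    X.presheaf.germ_stalkSpecializes_apply hxU h a
  have hunit (s : (hU.primeIdealOf ⟨y, hyU⟩).asIdeal.primeCompl) :
      IsUnit (X.presheaf.germ U y hyU s) :=
    IsLocalization.map_units (X.presheaf.stalk y) s
  have hne (s : (hU.primeIdealOf ⟨y, hyU⟩).asIdeal.primeCompl) :
      X.presheaf.germ U x hxU s ≠ 0 := by
    intro h0
    have hs := hunit s
    rw [← hgerm, h0, map_zero] at hs
    let _ := hK.toField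
    exact not_isUnit_zero hs
  have hinj : Function.Injective (toStalk h) := by
    rw [injective_iff_map_eq_zero]
    intro r hr
    obtain ⟨⟨a, s⟩, has⟩ := IsLocalization.surj
      (hU.primeIdealOf ⟨x, hxU⟩).asIdeal.primeCompl (S := X.presheaf.stalk x) r
    have has' : r * X.presheaf.germ U x hxU s = X.presheaf.germ U x hxU a := has
    have ha0 : X.presheaf.germ U y hyU a = 0 := by
      rw [← hgerm, ← has', map_mul, hr, zero_mul]
    obtain ⟨t, ht⟩ := (IsLocalization.map_eq_zero_iff
      (hU.primeIdealOf ⟨y, hyU⟩).asIdeal.primeCompl (X.presheaf.stalk y) a).mp ha0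
    have hax : X.presheaf.germ U x hxU a = 0 := by
      have h1 := congrArg (X.presheaf.germ U x hxU) ht
      rw [map_mul, map_zero] at h1
      exact (mul_eq_zero.mp h1).resolve_left (hne t)
    rw [hax] at has'
    have hs : IsUnit (X.presheaf.germ U x hxU s) :=
      IsLocalization.map_units (X.presheaf.stalk x) s
    exact (hs.mul_left_eq_zero).mp has'
  refine ⟨hK, ?_⟩
  let _ := hK.toField
  let _ := (toStalk h).toAlgebra
  have : FaithfulSMul (X.presheaf.stalk x) (X.presheaf.stalk y) :=
    (faithfulSMul_iff_algebraMap_injective _ _).mpr hinj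
  refine IsFractionRing.of_field _ _ fun z ↦ ?_
  obtain ⟨⟨a, s⟩, has⟩ := IsLocalization.surj
    (hU.primeIdealOf ⟨y, hyU⟩).asIdeal.primeCompl (S := X.presheaf.stalk y) z
  refine ⟨X.presheaf.germ U x hxU a, X.presheaf.germ U x hxU s, ?_⟩
  have h1 : z * X.presheaf.germ U y hyU s = X.presheaf.germ U y hyU a := has
  rw [← hgerm, ← hgerm] at h1
  refine eq_div_of_mul_eq ?_ h1
  exact fun h0 ↦ hne s (hinj (h0.trans (map_zero _).symm))

theorem IsFractionMap.injective {R K : Type*} [CommRing R] [CommRing K] {f : R →+* K}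
    (hf : IsFractionMap f) : Function.Injective f := by
  let _ := f.toAlgebra
  have : IsFractionRing R K := hf.2
  exact IsFractionRing.injective R K

theorem exists_genericPoint_specializes {X : Scheme.{u}} (x : X) :
    ∃ η : genericPoints X, η.1 ⤳ x := by
  have h := irreducibleComponent_mem_irreducibleComponents x
  exact ⟨genericPoints.ofComponent ⟨_, h⟩,
    (genericPoints.isGenericPoint_ofComponent ⟨_, h⟩).specializes mem_irreducibleComponent⟩

theorem eq_of_specializes_of_mem_genericPoints {X : Scheme.{u}} {x y : X}
    (hy : y ∈ genericPoints X) (h : x ⤳ y) : x = y := by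
  refine (h.antisymm ?_).eq
  rw [specializes_iff_closure_subset]
  exact hy.2 isIrreducible_singleton.closure (specializes_iff_closure_subset.mp h)

/-- The spectrum of the stalk at `x` consists of the generizations of `x`; the stalk being a domain,
its zero ideal maps to every generic point among them. -/
theorem genericPoint_specializes_unique {X : Scheme.{u}} [IsNormal X] {x : X}
    {η ξ : genericPoints X} (hη : η.1 ⤳ x) (hξ : ξ.1 ⤳ x) : η = ξ := by
  have := IsNormal.isDomain_stalk x
  have key (ζ : genericPoints X) (hζ : ζ.1 ⤳ x) :
      X.fromSpecStalk x (⊥ : PrimeSpectrum (X.presheaf.stalk x)) = ζ.1 := by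
    obtain ⟨p, hp⟩ : ζ.1 ∈ Set.range (X.fromSpecStalk x) := by
      rw [Scheme.range_fromSpecStalk]
      exact hζ
    refine eq_of_specializes_of_mem_genericPoints ζ.2 ?_
    rw [← hp]
    exact ((PrimeSpectrum.le_iff_specializes _ _).mp bot_le).map (X.fromSpecStalk x).continuous
  exact Subtype.ext ((key η hη).symm.trans (key ξ hξ))

/-- On a separated normal scheme, an inclusion of local rings inside the function field comes from
a specialization. -/
theorem specializes_of_range_le {X : Scheme.{u}} [X.IsSeparated] [IsNormal X] {x y η : X}
    (hη : η ∈ genericPoints X) (hx : η ⤳ x) (hy : η ⤳ y)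
    (h : (toStalk hx).range ≤ (toStalk hy).range) : y ⤳ x := by
  have := IsNormal.isDomain_stalk y
  have hinj : Function.Injective (toStalk hy) := (isFractionMap_toStalk hη hy).injective
  let e : X.presheaf.stalk y ≃+* (toStalk hy).range :=
    RingEquiv.ofBijective _ ⟨fun a b hab ↦ hinj (congrArg Subtype.val hab),
      (toStalk hy).rangeRestrict_surjective⟩
  let g : X.presheaf.stalk x →+* X.presheaf.stalk y :=
    (e.symm : (toStalk hy).range →+* X.presheaf.stalk y).comp
      ((Subring.inclusion h).comp (toStalk hx).rangeRestrict)
  have hg (r) : toStalk hy (g r) = toStalk hx r :=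
    congrArg Subtype.val (e.apply_symm_apply (Subring.inclusion h ((toStalk hx).rangeRestrict r)))
  have hcomp : CommRingCat.ofHom g ≫ X.presheaf.stalkSpecializes hy =
      X.presheaf.stalkSpecializes hx := by
    ext r
    exact hg r
  have hdom : IsDominant (Spec.map (X.presheaf.stalkSpecializes hy)) := by
    rw [isDominant_iff]
    refine (PrimeSpectrum.denseRange_comap_iff_ker_le_nilRadical
      (X.presheaf.stalkSpecializes hy).hom).mpr ?_
    rw [(RingHom.injective_iff_ker_eq_bot _).mp hinj]
    exact bot_le
  -- Both morphisms to the separated scheme `X` agree after the dominant map from the spectrum of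
  -- the stalk at `η`, hence agree.
  have heq : Spec.map (CommRingCat.ofHom g) ≫ X.fromSpecStalk x = X.fromSpecStalk y := by
    refine ext_of_isDominant (Spec.map (X.presheaf.stalkSpecializes hy)) ?_
    rw [← Category.assoc, ← Spec.map_comp, hcomp, Scheme.SpecMap_stalkSpecializes_fromSpecStalk,
      Scheme.SpecMap_stalkSpecializes_fromSpecStalk]
  have hmem : y ∈ Set.range (X.fromSpecStalk x) := by
    rw [← Scheme.fromSpecStalk_closedPoint (x := y), ← heq]
    exact ⟨_, rfl⟩
  rwa [Scheme.range_fromSpecStalk] at hmem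

theorem PrimeDivisor.not_range_le {X : Scheme.{u}} [X.IsSeparated] [IsNormal X]
    {P Q : PrimeDivisor X} (hPQ : P ≠ Q) {η : X} (hη : η ∈ genericPoints X)
    (hP : η ⤳ P.genericPoint) (hQ : η ⤳ Q.genericPoint) :
    ¬ (toStalk hP).range ≤ (toStalk hQ).range := by
  intro h
  refine hPQ (PrimeDivisor.eq_of_le ?_)
  have h1 := specializes_iff_closure_subset.mp (specializes_of_range_le hη hP hQ h)
  rwa [P.closure_genericPoint, Q.closure_genericPoint] at h1

/-! ### Orders of rational functions along prime divisors -/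

theorem hasOrder_iff {X : Scheme.{u}} [IsNormal X] {φ : RationalFunctions X} {x : X}
    {η : genericPoints X} (h : η.1 ⤳ x) {n : ℤ} :
    HasOrder φ x n ↔ HasOrd (toStalk h) (φ η) n := by
  constructor
  · rintro ⟨a, ha, b, hb, hab, hkl⟩
    exact ⟨a, ha, b, hb, hab η h, hkl⟩
  · rintro ⟨a, ha, b, hb, hab, hkl⟩
    refine ⟨a, ha, b, hb, fun ξ hξ ↦ ?_, hkl⟩
    obtain rfl := genericPoint_specializes_unique h hξ
    exact hab

theorem isRegularNonvanishingAt_iff {X : Scheme.{u}} [IsNormal X] {φ : RationalFunctions X} {x : X}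
    {η : genericPoints X} (h : η.1 ⤳ x) :
    IsRegularNonvanishingAt φ x ↔ ∃ a : (X.presheaf.stalk x)ˣ, toStalk h a = φ η := by
  refine exists_congr fun a ↦ ⟨fun ha ↦ ha η h, fun ha ξ hξ ↦ ?_⟩
  obtain rfl := genericPoint_specializes_unique h hξ
  exact ha

theorem isField_stalk_genericPoint {X : Scheme.{u}} [IsNormal X] (η : genericPoints X) :
    IsField (X.presheaf.stalk η.1) :=
  have := IsNormal.isReduced X
  isField_stalk_of_closure_mem_irreducibleComponents X η.1 η.2

section PrimeDivisor

theorem PrimeDivisor.isDomain_stalk {X : Scheme.{u}} [IsNormal X] (P : PrimeDivisor X) :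
    IsDomain (X.presheaf.stalk P.genericPoint) :=
  IsNormal.isDomain_stalk _

variable {X : Scheme.{u}} [IsLocallyNoetherian X] [IsNormal X] (P : PrimeDivisor X)

theorem PrimeDivisor.isDiscreteValuationRing_stalk
    [IsDomain (X.presheaf.stalk P.genericPoint)] :
    IsDiscreteValuationRing (X.presheaf.stalk P.genericPoint) :=
  Mumford.isDiscreteValuationRing_stalk P.coheight_genericPoint

attribute [local instance] PrimeDivisor.isDomain_stalk PrimeDivisor.isDiscreteValuationRing_stalk

theorem PrimeDivisor.hasOrder_unique {φ : RationalFunctions X} {m n : ℤ}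
    (hm : HasOrder φ P.genericPoint m) (hn : HasOrder φ P.genericPoint n) : m = n := by
  obtain ⟨η, hη⟩ := exists_genericPoint_specializes P.genericPoint
  rw [hasOrder_iff hη] at hm hn
  exact (isFractionMap_toStalk η.2 hη).hasOrd_unique hm hn

theorem PrimeDivisor.hasOrder_zero_iff {φ : RationalFunctions X} :
    HasOrder φ P.genericPoint 0 ↔ IsRegularNonvanishingAt φ P.genericPoint := by
  obtain ⟨η, hη⟩ := exists_genericPoint_specializes P.genericPoint
  rw [hasOrder_iff hη, isRegularNonvanishingAt_iff hη]
  exact (isFractionMap_toStalk η.2 hη).hasOrd_zero_iff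

theorem PrimeDivisor.exists_hasOrder (φ : (RationalFunctions X)ˣ) :
    ∃ n, HasOrder (φ : RationalFunctions X) P.genericPoint n := by
  obtain ⟨η, hη⟩ := exists_genericPoint_specializes P.genericPoint
  simp_rw [hasOrder_iff hη]
  refine (isFractionMap_toStalk η.2 hη).exists_hasOrd fun h0 ↦ ?_
  let _ := (isField_stalk_genericPoint η).toField
  have h1 : φ.1 η * φ.inv η = 1 := congrFun φ.val_inv η
  rw [h0, zero_mul] at h1
  exact zero_ne_one h1

/-- There is a rational function with prescribed orders along finitely many prime divisors. -/
theorem exists_hasOrder_eq [X.IsSeparated] {D : Set (PrimeDivisor X)} (hD : D.Finite)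
    (m : PrimeDivisor X → ℤ) :
    ∃ φ : (RationalFunctions X)ˣ,
      ∀ P ∈ D, HasOrder (φ : RationalFunctions X) P.genericPoint (m P) := by
  have := hD.to_subtype
  -- Approximate separately in each function field; the resulting family is a rational function.
  have key (η : genericPoints X) : ∃ z : X.presheaf.stalk η.1, z ≠ 0 ∧
      ∀ i : {P : D // η.1 ⤳ P.1.genericPoint}, HasOrd (toStalk i.2) z (m i.1.1) :=
    IsFractionMap.exists_hasOrd_eq
      (R := fun i : {P : D // η.1 ⤳ P.1.genericPoint} ↦ X.presheaf.stalk i.1.1.genericPoint)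
      (isField_stalk_genericPoint η) (fun i ↦ isFractionMap_toStalk η.2 i.2)
      (fun i j hij ↦ PrimeDivisor.not_range_le (fun h ↦ hij (Subtype.ext (Subtype.ext h)))
        η.2 i.2 j.2) _
  choose z hz0 hz using key
  choose w hw using fun η ↦ (isField_stalk_genericPoint η).mul_inv_cancel (hz0 η)
  refine ⟨⟨z, w, funext hw, funext fun η ↦ (mul_comm _ _).trans (hw η)⟩, fun P hP ↦ ?_⟩
  obtain ⟨η, hη⟩ := exists_genericPoint_specializes P.genericPoint
  exact (hasOrder_iff hη).mpr (hz η ⟨⟨P, hP⟩, hη⟩)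

end PrimeDivisor

/-! ### Finiteness of the divisor of a rational function -/

/-- In a noetherian scheme, a generic point of a component has an open neighbourhood that meets no
other component. -/
theorem exists_opens_forall_specializes_eq {X : Scheme.{u}} [IsNoetherian X]
    (η : genericPoints X) :
    ∃ V : X.Opens, η.1 ∈ V ∧ ∀ x ∈ V, ∀ ξ : genericPoints X, ξ.1 ⤳ x → ξ = η := by
  have := (genericPoints.finite (NoetherianSpace.finite_irreducibleComponents (α := X))).to_subtype
  have hcl : IsClosed (⋃ ξ : {ξ : genericPoints X // ξ ≠ η}, closure {ξ.1.1}) :=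
    isClosed_iUnion_of_finite fun _ ↦ isClosed_closure
  refine ⟨⟨_, hcl.isOpen_compl⟩, fun h ↦ ?_, fun x hx ξ hξ ↦ ?_⟩
  · obtain ⟨ξ, hξ⟩ := Set.mem_iUnion.mp h
    exact ξ.2 (Subtype.ext
      (eq_of_specializes_of_mem_genericPoints η.2 (specializes_iff_mem_closure.mpr hξ)))
  · by_contra hne
    exact hx (Set.mem_iUnion.mpr ⟨⟨ξ, hne⟩, specializes_iff_mem_closure.mp hξ⟩)

/-- Near each generic point `φ` is given by a section. On a neighbourhood missing the other
components it represents `φ` wherever it is defined, and its unit locus is open. -/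
theorem exists_opens_isRegularNonvanishingAt {X : Scheme.{u}} [IsNoetherian X]
    (φ : (RationalFunctions X)ˣ) :
    ∃ V : X.Opens, genericPoints X ⊆ V ∧
      ∀ x ∈ V, IsRegularNonvanishingAt (φ : RationalFunctions X) x := by
  choose V hV hVη using exists_opens_forall_specializes_eq (X := X)
  choose U hUV hU s hs using fun η : genericPoints X ↦
    X.presheaf.exists_le_germ_eq (φ.1 η) (hV η)
  refine ⟨⨆ η, X.basicOpen (s η), fun η hη ↦ ?_, fun x hx ↦ ?_⟩
  · refine Opens.mem_iSup.mpr ⟨⟨η, hη⟩, ?_⟩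
    rw [Scheme.mem_basicOpen X _ _ (hU ⟨η, hη⟩)]
    have h1 := hs ⟨η, hη⟩
    have h2 : IsUnit (φ.1 ⟨η, hη⟩) :=
      IsUnit.of_mul_eq_one _ (congrFun φ.val_inv ⟨η, hη⟩)
    exact h1 ▸ h2
  · obtain ⟨η, hη⟩ := Opens.mem_iSup.mp hx
    have hxU : x ∈ U η := X.basicOpen_le _ hη
    rw [Scheme.mem_basicOpen X _ _ hxU] at hη
    refine ⟨hη.unit, fun ξ hξ ↦ ?_⟩
    obtain rfl := hVη η x (hUV η hxU) ξ hξ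
    exact (X.presheaf.germ_stalkSpecializes_apply hxU hξ (s ξ)).trans (hs ξ)

/-- A prime divisor inside `Z` lies in one of the finitely many irreducible pieces of `Z`. It must
equal that piece: a strictly larger piece would be a component, with its generic point in `Z`. -/
theorem finite_setOf_subset_of_isClosed {X : Scheme.{u}} [IsNoetherian X] {Z : Set X}
    (hZ : IsClosed Z) (hZ' : Disjoint (genericPoints X) Z) :
    {P : PrimeDivisor X | P.genericPoint ∈ Z}.Finite := by
  obtain ⟨S, hS, hSc, hSi, rfl⟩ := NoetherianSpace.exists_finite_set_isClosed_irreducible hZ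
  lift S to Finset (Set X) using hS
  have key (P : PrimeDivisor X) (hP : P.genericPoint ∈ ⋃₀ (S : Set (Set X))) :
      (P.toIrreducibleCloseds : Set X) ∈ S := by
    have hsub : (P.toIrreducibleCloseds : Set X) ⊆ ⋃₀ (S : Set (Set X)) := by
      rw [← P.closure_genericPoint]
      exact hZ.closure_subset_iff.mpr (Set.singleton_subset_iff.mpr hP)
    obtain ⟨W, hW, hPW⟩ := isIrreducible_iff_sUnion_isClosed.mp
      P.toIrreducibleCloseds.isIrreducible' S hSc hsub
    let W' : IrreducibleCloseds X := ⟨W, hSi W hW, hSc W hW⟩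
    have hle : P.toIrreducibleCloseds ≤ W' := hPW
    rcases hle.eq_or_lt with h | h
    · rw [h]
      exact hW
    · have hcomp : W ∈ irreducibleComponents X := PrimeDivisor.mem_irreducibleComponents_of_lt h
      refine (Set.disjoint_left.mp hZ' (genericPoints.ofComponent ⟨W, hcomp⟩).2 ?_).elim
      exact ⟨W, hW, (genericPoints.isGenericPoint_ofComponent ⟨W, hcomp⟩).mem⟩
  refine Set.Finite.of_finite_image (S.finite_toSet.subset ?_)
    (f := fun P : PrimeDivisor X ↦ (P.toIrreducibleCloseds : Set X)) ?_
  · rintro _ ⟨P, hP, rfl⟩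
    exact key P hP
  · exact fun P _ Q _ h ↦ PrimeDivisor.eq_of_le (le_of_eq (IrreducibleCloseds.ext h))

theorem exists_isDivisorOf {X : Scheme.{u}} [IsNoetherian X] [IsNormal X]
    (φ : (RationalFunctions X)ˣ) :
    ∃ B : WeilDivisor X, IsDivisorOf (φ : RationalFunctions X) B := by
  choose n hn using fun P : PrimeDivisor X ↦ P.exists_hasOrder φ
  obtain ⟨V, hV, hφ⟩ := exists_opens_isRegularNonvanishingAt φ
  have hfin := finite_setOf_subset_of_isClosed V.isOpen.isClosed_compl
    (Set.disjoint_compl_right_iff_subset.mpr hV)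
  refine ⟨Finsupp.ofSupportFinite n (hfin.subset fun P hP hPV ↦ hP ?_), hn⟩
  exact P.hasOrder_unique (hn P) (P.hasOrder_zero_iff.mpr (hφ _ hPV))

/-! ### Comparison of the two class groups -/

theorem mumfordDivisors_inclusion_ker {X : Scheme.{u}} [IsNoetherian X] [IsNormal X]
    (D : Set (PrimeDivisor X)) :
    principalMumfordDivisors X D =
      (principalDivisors X).comap (mumfordDivisors X D).subtype := by
  ext B
  refine ⟨fun ⟨φ, hφ, _⟩ ↦ ⟨φ, hφ⟩, fun ⟨φ, hφ⟩ ↦ ⟨φ, hφ, fun P hP ↦ ?_⟩⟩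
  refine P.hasOrder_zero_iff.mp ?_
  have h := hφ P
  rwa [AddSubgroup.subtype_apply, B.2 P hP] at h

theorem exists_mumfordDivisor_sub_mem {X : Scheme.{u}} [IsNoetherian X] [X.IsSeparated]
    [IsNormal X] {D : Set (PrimeDivisor X)} (hD : D.Finite) (B : WeilDivisor X) :
    ∃ C : mumfordDivisors X D, -(C : WeilDivisor X) + B ∈ principalDivisors X := by
  obtain ⟨φ, hφ⟩ := exists_hasOrder_eq hD B
  obtain ⟨A, hA⟩ := exists_isDivisorOf φ
  refine ⟨⟨B - A, fun P hP ↦ ?_⟩, φ, ?_⟩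
  · rw [Finsupp.sub_apply, P.hasOrder_unique (hA P) (hφ P hP), sub_self]
  · simpa using hA

end Mumford

theorem lemma1p2 (X : AlgebraicGeometry.Scheme.{u}) [AlgebraicGeometry.IsNoetherian X]
    [X.IsSeparated] [Mumford.IsNormal X] (D : Set (Mumford.PrimeDivisor X)) (hD : D.Finite) :
    ∃ e : Mumford.MumfordClassGroup X D ≃+ Mumford.ClassGroup X,
      ∀ B : Mumford.mumfordDivisors X D,
        e (QuotientAddGroup.mk B) = QuotientAddGroup.mk (B : Mumford.WeilDivisor X) := by
  have hker := Mumford.mumfordDivisors_inclusion_ker D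
  let f : Mumford.MumfordClassGroup X D →+ Mumford.ClassGroup X :=
    QuotientAddGroup.map _ _ (Mumford.mumfordDivisors X D).subtype hker.le
  refine ⟨AddEquiv.ofBijective f ⟨?_, ?_⟩, fun B ↦ rfl⟩
  · rw [injective_iff_map_eq_zero]
    intro b hb
    induction b using QuotientAddGroup.induction_on with
    | H B =>
      rw [QuotientAddGroup.eq_zero_iff, hker]
      exact (QuotientAddGroup.eq_zero_iff (B : Mumford.WeilDivisor X)).mp hb
  · intro b
    induction b using QuotientAddGroup.induction_on with
    | H B =>
      obtain ⟨C, hC⟩ := Mumford.exists_mumfordDivisor_sub_mem hD B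
      exact ⟨QuotientAddGroup.mk C, QuotientAddGroup.eq.mpr hC⟩
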